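/- For $v\in\mathbb{R}$ and $x>0$ let $$I_v(x)=\sum_{n=0}^{\infty}\frac{(x/2)^{2n+v}}{n!\,\Gamma(v+n+1)}$$ (with $1/\Gamma=0$ at the poles of $\Gamma$) be the modified Bessel function of the first kind, and let $K_v$ be the modified Bessel function of the second kind, $$K_v(x)=\frac{\pi}{2}\,\frac{I_{-v}(x)-I_v(x)}{\sin(v\pi)}\quad\text{if } v\notin\mathbb{Z},\qquad K_v(x)=\lim_{\mu\to v,\ \mu\neq v}\frac{\pi}{2}\,\frac{I_{-\mu}(x)-I_\mu(x)}{\sin(\mu\pi)}\quad\text{if } v\in\mathbb{Z}.$$ Let $v\in\mathbb{R}$ with $|v|\neq \tfrac12$ and let $x>0$. Then $K_v(x)\neq 0$. If $|v|>\tfrac12$, then $$\frac{K_{v-1}(x)K_{v+1}(x)}{K_v(x)^2}<1+\frac1x ,\quad\text{or equivalently}\quad K_v(x)^2-K_{v-1}(x)K_{v+1}(x)>-\frac1x K_v(x)^2 .$$ If $|v|<\tfrac12$, then $$\frac{K_{v-1}(x)K_{v+1}(x)}{K_v(x)^2}>1+\frac1x ,\quad\text{or equivalently}\quad K_v(x)^2-K_{v-1}(x)K_{v+1}(x)<-\frac1x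 K_v(x)^2 .$$ -/

import Mathlib

/-- The modified Bessel function of the first kind of real order `v`,
`I_v(x) = ∑ₙ (x/2)^(2n+v) / (n! Γ(v+n+1))`, meant for `x > 0`.  At a nonpositive integer Mathlib
sets `Real.Gamma` to `0`, so the corresponding term is `0`, in agreement with the usual convention
`1/Γ = 0` at the poles. -/
noncomputable def besselI (v x : ℝ) : ℝ :=
  ∑' n : ℕ, (x / 2) ^ (2 * (n : ℝ) + v) / ((n.factorial : ℝ) * Real.Gamma (v + n + 1))

/-- The quotient `(π/2) (I_{-v}(x) - I_v(x)) / sin(vπ)`, meaningful for non-integer `v`. -/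
noncomputable def besselKQuot (v x : ℝ) : ℝ :=
  Real.pi / 2 * ((besselI (-v) x - besselI v x) / Real.sin (v * Real.pi))

open Classical in
/-- The modified Bessel function of the second kind of real order `v`, meant for `x > 0`: the
quotient `(π/2) (I_{-v}(x) - I_v(x)) / sin(vπ)` if `v` is not an integer, and its limiting value
as the order tends to `v` if `v` is an integer. -/
noncomputable def besselK (v x : ℝ) : ℝ :=
  if v ∈ Set.range ((↑) : ℤ → ℝ) then
    Filter.limUnder (nhdsWithin v {v}ᶜ) (fun μ : ℝ => besselKQuot μ x)
  else besselKQuot v x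

open Real Set Filter Topology MeasureTheory

/-! For `x > 0`, `K_v(x) = (1/2)(x/2)^(-v) ∫₀^∞ s^(v-1) exp(-s - x²/(4s)) ds`. The integral makes
`K_v` positive and continuous in `v`, and yields the recurrence, the derivative and decay at
infinity.

The recurrence turns `T = x²((1 + 1/x) K_v² - K_{v-1} K_{v+1})` into a quadratic form in `K_v`,
`K_{v-1}`, and `T' = K_v A` with `A = (2x + 1 - 2v) K_v - 2x K_{v-1}`. Moreover `exp(-x) x^(-1/2) A`
has derivative a positive multiple of `v² - 1/4`. Both functions vanish at infinity, so that sign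
passes, reversed each time, to `A` and then to `T` (`hasDerivAt_exp_mul_besselKAux`,
`hasDerivAt_besselKTuran`).

The integral is matched with the definition of `K_v` through constant Wronskians
(`besselIntegral_mul_sin`), and by continuity in the order at integers (`besselK_eq`). -/

/-! ### The power series of `I_v` -/

theorem Real.inv_Gamma_eq_self_mul_inv_Gamma_add_one (s : ℝ) :
    (Gamma s)⁻¹ = s * (Gamma (s + 1))⁻¹ := by
  -- The convention `Gamma 0 = 0` keeps the identity true at the poles, so the recurrences need no
  -- restriction on `v`.
  rcases eq_or_ne s 0 with rfl | hs
  · simp [Gamma_zero]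
  · rw [Gamma_add_one hs, mul_inv, ← mul_assoc, mul_inv_cancel₀ hs, one_mul]

/-- Coefficients of the entire function `z ↦ z ^ (-v / 2) * I_v (2 * √z)`. -/
noncomputable def besselCoeff (v : ℝ) (n : ℕ) : ℝ :=
  ((n.factorial : ℝ) * Gamma (v + n + 1))⁻¹

/-- The entire function `z ↦ z ^ (-v / 2) * I_v (2 * √z)`. -/
noncomputable def besselSeries (v z : ℝ) : ℝ := ∑' n : ℕ, besselCoeff v n * z ^ n

theorem exists_abs_inv_Gamma_le (v : ℝ) : ∃ M, ∀ n : ℕ, |(Gamma (v + n + 1))⁻¹| ≤ M := by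
  -- For `n ≥ 1 - v` the argument is at least `2`, where `Gamma` increases from `1`; finitely many
  -- `n` remain.
  obtain ⟨N, hN⟩ := exists_nat_ge (1 - v)
  have h1 : ∀ n : ℕ, N ≤ n → |(Gamma (v + n + 1))⁻¹| ≤ 1 := by
    intro n hn
    have hn' : (N : ℝ) ≤ n := by exact_mod_cast hn
    have h2 : 1 ≤ Gamma (v + n + 1) := by
      refine Gamma_two.symm.le.trans (Gamma_strictMonoOn_Ici.monotoneOn (by simp) ?_ ?_)
      · rw [mem_Ici]; linarith
      · linarith
    rw [abs_of_nonneg (by positivity)]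
    exact inv_le_one_of_one_le₀ h2
  refine ⟨1 + ∑ k ∈ Finset.range N, |(Gamma (v + k + 1))⁻¹|, fun n => ?_⟩
  rcases le_or_gt N n with h | h
  · exact (h1 n h).trans (le_add_of_nonneg_right (Finset.sum_nonneg fun _ _ => abs_nonneg _))
  · have := Finset.single_le_sum (f := fun k : ℕ => |(Gamma (v + k + 1))⁻¹|)
      (fun _ _ => abs_nonneg _) (Finset.mem_range.2 h)
    linarith

theorem exists_abs_besselCoeff_le (v : ℝ) :
    ∃ M, ∀ n : ℕ, |besselCoeff v n| ≤ M / (n.factorial : ℝ) := by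
  obtain ⟨M, hM⟩ := exists_abs_inv_Gamma_le v
  refine ⟨M, fun n => ?_⟩
  rw [besselCoeff, mul_inv, abs_mul, abs_of_nonneg (a := ((n.factorial : ℝ))⁻¹) (by positivity),
    div_eq_inv_mul]
  exact mul_le_mul_of_nonneg_left (hM n) (by positivity)

theorem besselCoeff_succ (v : ℝ) (n : ℕ) :
    ((n + 1 : ℕ) : ℝ) * besselCoeff v (n + 1) = besselCoeff (v + 1) n := by
  rw [besselCoeff, besselCoeff, Nat.factorial_succ]
  push_cast
  rw [show v + 1 + (n : ℝ) + 1 = v + ((n : ℝ) + 1) + 1 by ring, mul_assoc, mul_inv, ← mul_assoc,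
    mul_inv_cancel₀ (by positivity), one_mul]

theorem besselCoeff_sub_one (v : ℝ) (n : ℕ) :
    besselCoeff (v - 1) n = v * besselCoeff v n + n * besselCoeff v n := by
  rw [besselCoeff, besselCoeff, mul_inv, mul_inv, show v - 1 + (n : ℝ) + 1 = v + n by ring,
    Real.inv_Gamma_eq_self_mul_inv_Gamma_add_one (v + n)]
  ring

theorem summable_besselSeries (v z : ℝ) : Summable fun n : ℕ => besselCoeff v n * z ^ n := by
  obtain ⟨M, hM⟩ := exists_abs_besselCoeff_le v
  refine .of_norm_bounded ((Real.summable_pow_div_factorial |z|).mul_left M) fun n => ?_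
  rw [norm_eq_abs, abs_mul, abs_pow]
  refine (mul_le_mul_of_nonneg_right (hM n) (by positivity)).trans_eq ?_
  ring

theorem hasSum_deriv_besselSeries (v z : ℝ) :
    HasSum (fun n : ℕ => besselCoeff v n * (n * z ^ (n - 1))) (besselSeries (v + 1) z) := by
  rw [← hasSum_nat_add_iff' 1]
  simp only [Finset.range_one, Finset.sum_singleton, Nat.cast_zero, zero_mul, mul_zero, sub_zero,
    Nat.add_sub_cancel]
  refine (summable_besselSeries (v + 1) z).hasSum.congr_fun ?_
  intro n
  rw [← besselCoeff_succ]
  ring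

theorem hasDerivAt_besselSeries (v z : ℝ) :
    HasDerivAt (besselSeries v) (besselSeries (v + 1) z) z := by
  obtain ⟨M, hM⟩ := exists_abs_besselCoeff_le v
  have hu : Summable fun n : ℕ => M / (n.factorial : ℝ) * (n * (|z| + 1) ^ (n - 1)) := by
    rw [← summable_nat_add_iff 1]
    refine ((Real.summable_pow_div_factorial (|z| + 1)).mul_left M).congr fun n => ?_
    rw [Nat.factorial_succ, Nat.add_sub_cancel]
    push_cast
    field_simp
  have hz : z ∈ Metric.ball (0 : ℝ) (|z| + 1) := by simp
  have := hasDerivAt_tsum_of_isPreconnected (g := fun n z => besselCoeff v n * z ^ n)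
    (g' := fun n z => besselCoeff v n * (n * z ^ (n - 1))) hu Metric.isOpen_ball
    (convex_ball (0 : ℝ) (|z| + 1)).isPreconnected
    (fun n y _ => (hasDerivAt_pow n y).const_mul _) (fun n y hy => ?_) hz
    (summable_besselSeries v z) hz
  · rwa [(hasSum_deriv_besselSeries v z).tsum_eq] at this
  · rw [norm_mul, norm_mul, norm_pow, norm_natCast]
    have hy' : ‖y‖ ≤ |z| + 1 := by simpa using (mem_ball_zero_iff.1 hy).le
    have h0 := hM n
    gcongr
    exact (abs_nonneg _).trans h0
    exact h0

theorem besselSeries_sub_one (v z : ℝ) :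
    besselSeries (v - 1) z = v * besselSeries v z + z * besselSeries (v + 1) z := by
  refine HasSum.tsum_eq ?_
  refine (((summable_besselSeries v z).hasSum.mul_left v).add
    ((hasSum_deriv_besselSeries v z).mul_left z)).congr_fun fun n => ?_
  rw [besselCoeff_sub_one]
  rcases n with _ | n
  · simp
  · rw [Nat.add_sub_cancel, pow_succ]
    ring

theorem besselSeries_zero (v : ℝ) : besselSeries v 0 = (Gamma (v + 1))⁻¹ := by
  rw [besselSeries, tsum_eq_single 0 (fun n hn => by simp [hn])]
  simp [besselCoeff]

/-- The Wronskian of `I_v` and `I_{-v}`. -/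
theorem besselSeries_wronskian (v z : ℝ) :
    besselSeries (v - 1) z * besselSeries (-v) z -
      z * besselSeries (1 - v) z * besselSeries v z = sin (π * v) / π := by
  have hd : ∀ y, HasDerivAt (fun z => besselSeries (v - 1) z * besselSeries (-v) z -
      z * besselSeries (1 - v) z * besselSeries v z) 0 y := by
    intro y
    have h1 := hasDerivAt_besselSeries (v - 1) y
    have h2 := hasDerivAt_besselSeries (-v) y
    have h3 := hasDerivAt_besselSeries (1 - v) y
    have h4 := hasDerivAt_besselSeries v y
    refine ((h1.mul h2).sub (((hasDerivAt_id' y).mul h3).mul h4)).congr_deriv ?_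
    have e1 := besselSeries_sub_one v y
    have e2 := besselSeries_sub_one (1 - v) y
    rw [show 1 - v - 1 = -v by ring] at e2
    rw [show v - 1 + 1 = v by ring, show -v + 1 = 1 - v by ring, e1, e2]
    simp only [Pi.mul_apply]
    ring
  have := is_const_of_deriv_eq_zero (fun y => (hd y).differentiableAt) (fun y => (hd y).deriv) z 0
  rw [this]
  simp only [besselSeries_zero, zero_mul, sub_zero]
  rw [show v - 1 + 1 = v by ring, show -v + 1 = 1 - v by ring, ← mul_inv,
    Gamma_mul_Gamma_one_sub, inv_div]

theorem besselI_eq (v : ℝ) {x : ℝ} (hx : 0 < x) :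
    besselI v x = (x / 2) ^ v * besselSeries v (x ^ 2 / 4) := by
  rw [besselI, besselSeries, ← tsum_mul_left]
  refine tsum_congr fun n => ?_
  rw [rpow_add (by positivity), rpow_mul (by positivity), rpow_natCast, besselCoeff,
    show x ^ 2 / 4 = (x / 2) ^ (2 : ℝ) by norm_num; ring]
  ring

/-! ### The integral representation -/

/-- The integrand of `besselIntegral`. -/
noncomputable def besselKernel (v z s : ℝ) : ℝ := s ^ (v - 1) * exp (-s - z / s)

/-- The integral `∫₀^∞ s ^ (v - 1) * exp (-s - z / s) ds`, equal to
`2 * z ^ (v / 2) * K_v (2 * √z)` for `0 < z`. -/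
noncomputable def besselIntegral (v z : ℝ) : ℝ := ∫ s in Ioi 0, besselKernel v z s

theorem besselKernel_pos (v z : ℝ) {s : ℝ} (hs : 0 < s) : 0 < besselKernel v z s := by
  unfold besselKernel
  positivity

theorem continuousOn_besselKernel (v z : ℝ) : ContinuousOn (besselKernel v z) (Ioi 0) := by
  intro s hs
  have hs' : s ≠ 0 := (mem_Ioi.1 hs).ne'
  unfold besselKernel
  refine ContinuousAt.continuousWithinAt ?_
  refine (continuousAt_id.rpow_const (Or.inl hs')).mul ?_
  exact ((continuousAt_id.neg.sub (continuousAt_const.div continuousAt_id hs'))).rexp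

theorem aestronglyMeasurable_besselKernel (v z : ℝ) :
    AEStronglyMeasurable (besselKernel v z) (volume.restrict (Ioi 0)) :=
  (continuousOn_besselKernel v z).aestronglyMeasurable measurableSet_Ioi

/-- Since `t^n exp(-t) ≤ n!` with `t = z/s`, powers of `z` are traded for powers of `s`. This gives
integrability for every order, domination as `z → 0`, and decay as `z → ∞`. -/
theorem pow_mul_besselKernel_le (v : ℝ) {z s : ℝ} (hz : 0 ≤ z) (hs : 0 < s) (n : ℕ) :
    z ^ n * besselKernel v z s ≤ n.factorial * (exp (-s) * s ^ (v + n - 1)) := by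
  have h1 : (z / s) ^ n * exp (-(z / s)) ≤ n.factorial := by
    have := pow_div_factorial_le_exp (z / s) (by positivity) n
    rw [div_le_iff₀ (by positivity)] at this
    rw [exp_neg, ← div_eq_mul_inv, div_le_iff₀ (exp_pos _)]
    linarith
  have h2 : s ^ (v + n - 1) = s ^ (v - 1) * s ^ n := by
    rw [show v + n - 1 = v - 1 + n by ring, rpow_add hs, rpow_natCast]
  calc z ^ n * besselKernel v z s
      = ((z / s) ^ n * exp (-(z / s))) * (exp (-s) * s ^ (v + n - 1)) := by
        rw [besselKernel, h2, sub_eq_add_neg (-s), exp_add, div_pow]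
        field_simp
    _ ≤ _ := mul_le_mul_of_nonneg_right h1 (by positivity)

theorem integrableOn_besselKernel (v : ℝ) {z : ℝ} (hz : 0 < z) :
    IntegrableOn (besselKernel v z) (Ioi 0) := by
  obtain ⟨n, hn⟩ := exists_nat_gt (-v)
  have h := (GammaIntegral_convergent (s := v + n) (by linarith)).const_mul
    ((n.factorial : ℝ) / z ^ n)
  refine Integrable.mono' h (aestronglyMeasurable_besselKernel v z) ?_
  refine ae_restrict_of_forall_mem measurableSet_Ioi fun s hs => ?_
  rw [norm_of_nonneg (besselKernel_pos v z hs).le, div_mul_eq_mul_div, le_div_iff₀ (by positivity),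
    mul_comm]
  exact pow_mul_besselKernel_le v hz.le hs n

theorem besselIntegral_pos (v : ℝ) {z : ℝ} (hz : 0 < z) : 0 < besselIntegral v z := by
  rw [besselIntegral, setIntegral_pos_iff_support_of_nonneg_ae
    (ae_restrict_of_forall_mem measurableSet_Ioi fun s hs => (besselKernel_pos v z hs).le)
    (integrableOn_besselKernel v hz)]
  have hsub : Ioi 0 ⊆ Function.support (besselKernel v z) :=
    fun s hs => (besselKernel_pos v z hs).ne'
  rw [inter_eq_right.2 hsub]
  simp

theorem pow_mul_besselIntegral_le (v : ℝ) {z : ℝ} (hz : 0 < z) {n : ℕ} (hn : 0 < v + n) :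
    z ^ n * besselIntegral v z ≤ n.factorial * Gamma (v + n) := by
  rw [besselIntegral, Gamma_eq_integral hn, ← integral_const_mul, ← integral_const_mul]
  exact setIntegral_mono_on ((integrableOn_besselKernel v hz).const_mul _)
    ((GammaIntegral_convergent hn).const_mul _) measurableSet_Ioi
    fun s hs => pow_mul_besselKernel_le v hz.le hs n

theorem hasDerivAt_besselIntegral (v : ℝ) {z : ℝ} (hz : 0 < z) :
    HasDerivAt (besselIntegral v) (-besselIntegral (v - 1) z) z := by
  -- The kernel decreases in `z`, so its value at `z / 2` dominates on `Ioi (z / 2)`.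
  have h := hasDerivAt_integral_of_dominated_loc_of_deriv_le (μ := volume.restrict (Ioi (0 : ℝ)))
    (F := besselKernel v) (F' := fun z s => -besselKernel (v - 1) z s) (x₀ := z)
    (s := Ioi (z / 2)) (bound := besselKernel (v - 1) (z / 2)) (Ioi_mem_nhds (by linarith))
    (Eventually.of_forall fun y => aestronglyMeasurable_besselKernel v y)
    (integrableOn_besselKernel v hz) (aestronglyMeasurable_besselKernel (v - 1) z).neg
    (ae_restrict_of_forall_mem measurableSet_Ioi fun s hs y hy => ?_)
    (integrableOn_besselKernel (v - 1) (by positivity))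
    (ae_restrict_of_forall_mem measurableSet_Ioi fun s hs y hy => ?_)
  · rw [integral_neg] at h
    exact h.2
  · have hs' : 0 < s := hs
    rw [norm_neg, norm_of_nonneg (besselKernel_pos _ _ hs).le]
    unfold besselKernel
    have : z / 2 / s ≤ y / s := div_le_div_of_nonneg_right (le_of_lt hy) hs'.le
    gcongr
  · have hs' : 0 < s := hs
    have h1 : HasDerivAt (fun y => -s - y / s) (-(1 / s)) y :=
      ((hasDerivAt_id' y).div_const s).const_sub (-s)
    refine (h1.exp.const_mul (s ^ (v - 1))).congr_deriv ?_
    rw [besselKernel, rpow_sub_one hs'.ne' (v - 1)]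
    ring

/-- Substitution `s ↦ z / s`, carried out as a scaling and an inversion. -/
theorem besselIntegral_neg (v : ℝ) {z : ℝ} (hz : 0 < z) :
    besselIntegral (-v) z = z ^ (-v) * besselIntegral v z := by
  have h1 := integral_comp_mul_left_Ioi' (besselKernel (-v) z) 0 hz
  have h2 := integral_comp_rpow_Ioi (fun s => z • besselKernel (-v) z (z * s))
    (p := -1) (by norm_num)
  rw [mul_zero, ← integral_smul] at h1
  rw [besselIntegral, ← h1, ← h2, besselIntegral, ← integral_const_mul]
  refine setIntegral_congr_fun measurableSet_Ioi fun s hs => ?_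
  have hs' : 0 < s := hs
  simp only [smul_eq_mul, besselKernel, rpow_neg_one, abs_neg, abs_one, one_mul]
  rw [mul_rpow hz.le (by positivity), inv_rpow hs'.le, ← rpow_neg hs'.le,
    rpow_sub_one hz.ne', show (-1 - 1 : ℝ) = -2 by norm_num, show v - 1 = -2 + -(-v - 1) by ring,
    rpow_add hs', show -(z * s⁻¹) - z / (z * s⁻¹) = -s - z / s by field_simp; ring]
  field_simp

/-- Differentiating both sides of the reflection formula replaces an integration by parts. -/
theorem besselIntegral_add_one (v : ℝ) {z : ℝ} (hz : 0 < z) :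
    besselIntegral (v + 1) z = v * besselIntegral v z + z * besselIntegral (v - 1) z := by
  have h1 := hasDerivAt_besselIntegral (-v) hz
  have h2 : HasDerivAt (besselIntegral (-v)) (-v * z ^ (-v - 1) * besselIntegral v z +
      z ^ (-v) * (-besselIntegral (v - 1) z)) z := by
    refine HasDerivAt.congr_of_eventuallyEq
      ((hasDerivAt_rpow_const (Or.inl hz.ne')).mul (hasDerivAt_besselIntegral v hz)) ?_
    filter_upwards [Ioi_mem_nhds hz] with y hy
    exact besselIntegral_neg v hy
  have h3 := h1.unique h2
  rw [show -v - 1 = -(v + 1) by ring, besselIntegral_neg _ hz, neg_add, ← sub_eq_add_neg,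
    rpow_sub_one hz.ne'] at h3
  have hp : 0 < z ^ (-v) := by positivity
  field_simp at h3
  linarith

theorem tendsto_besselIntegral_zero {v : ℝ} (hv : 0 < v) :
    Tendsto (besselIntegral v) (𝓝[>] 0) (𝓝 (Gamma v)) := by
  rw [Gamma_eq_integral hv]
  refine tendsto_integral_filter_of_dominated_convergence
    (fun s => exp (-s) * s ^ (v - 1))
    (Eventually.of_forall fun y => aestronglyMeasurable_besselKernel v y) ?_
    (GammaIntegral_convergent hv)
    (ae_restrict_of_forall_mem measurableSet_Ioi fun s hs => ?_)
  · filter_upwards [self_mem_nhdsWithin] with z hz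
    refine ae_restrict_of_forall_mem measurableSet_Ioi fun s hs => ?_
    rw [norm_of_nonneg (besselKernel_pos _ _ hs).le]
    simpa using pow_mul_besselKernel_le v (le_of_lt hz) hs 0
  · have : Continuous fun z => besselKernel v z s := by unfold besselKernel; fun_prop
    have h := (this.tendsto 0).mono_left (nhdsWithin_le_nhds (s := Ioi 0))
    simpa [besselKernel, mul_comm] using h

theorem continuous_besselIntegral_order {z : ℝ} (hz : 0 < z) :
    Continuous fun v => besselIntegral v z := by
  refine continuous_iff_continuousAt.2 fun v => ?_
  refine MeasureTheory.continuousAt_of_dominated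
    (bound := fun s => besselKernel (v - 1) z s + besselKernel (v + 1) z s)
    (Eventually.of_forall fun y => aestronglyMeasurable_besselKernel y z) ?_
    ((integrableOn_besselKernel (v - 1) hz).add (integrableOn_besselKernel (v + 1) hz))
    (ae_restrict_of_forall_mem measurableSet_Ioi fun s hs => ?_)
  · filter_upwards [Ioo_mem_nhds (sub_one_lt v) (lt_add_one v)] with w hw
    refine ae_restrict_of_forall_mem measurableSet_Ioi fun s hs => ?_
    have hs' : 0 < s := hs
    rw [norm_of_nonneg (besselKernel_pos _ _ hs).le]
    unfold besselKernel
    rw [← add_mul]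
    refine mul_le_mul_of_nonneg_right ?_ (exp_pos _).le
    rcases le_total s 1 with h | h
    · exact (rpow_le_rpow_of_exponent_ge hs' h (by linarith [hw.1])).trans
        (le_add_of_nonneg_right (by positivity))
    · exact (rpow_le_rpow_of_exponent_le h (by linarith [hw.2])).trans
        (le_add_of_nonneg_left (by positivity))
  · have hs' : s ≠ 0 := (mem_Ioi.1 hs).ne'
    unfold besselKernel
    exact (ContinuousAt.rpow continuousAt_const (by fun_prop) (Or.inl hs')).mul continuousAt_const

/-! ### Matching the integral with the series -/

/-- The Wronskian of `I_v` and the integral solution is constant; case `-1 < v`. -/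
theorem besselIntegral_wronskian_of_neg_one_lt {v : ℝ} (hv : -1 < v) {z : ℝ} (hz : 0 < z) :
    besselIntegral (v + 1) z * besselSeries v z +
      z * besselIntegral v z * besselSeries (v + 1) z = 1 := by
  set W : ℝ → ℝ := fun z => besselIntegral (v + 1) z * besselSeries v z +
    z * besselIntegral v z * besselSeries (v + 1) z with hW
  have hd : ∀ y ∈ Ioi (0 : ℝ), HasDerivAt W 0 y := by
    intro y hy
    have h1 := hasDerivAt_besselIntegral (v + 1) hy
    have h2 := hasDerivAt_besselIntegral v hy
    have h3 := hasDerivAt_besselSeries v y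
    have h4 := hasDerivAt_besselSeries (v + 1) y
    refine ((h1.mul h3).add (((hasDerivAt_id' y).mul h2).mul h4)).congr_deriv ?_
    have e1 := besselSeries_sub_one (v + 1) y
    have e2 := besselIntegral_add_one v hy
    simp only [add_sub_cancel_right] at e1 ⊢
    simp only [Pi.mul_apply]
    rw [e1, e2]
    ring
  have hc : ∀ y ∈ Ioi (0 : ℝ), W y = W z := fun y hy =>
    isOpen_Ioi.is_const_of_deriv_eq_zero isPreconnected_Ioi
      (fun y hy => (hd y hy).differentiableAt.differentiableWithinAt)
      (fun y hy => (hd y hy).deriv) hy hz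
  have hs : ∀ w, Tendsto (besselSeries w) (𝓝[>] 0) (𝓝 (Gamma (w + 1))⁻¹) := fun w => by
    rw [← besselSeries_zero]
    exact (hasDerivAt_besselSeries w 0).continuousAt.tendsto.mono_left nhdsWithin_le_nhds
  have hl : Tendsto W (𝓝[>] 0) (𝓝 1) := by
    -- The order `v` may be nonpositive, so the recurrence replaces `z * besselIntegral v z` by
    -- terms of orders `v + 2` and `v + 1`, whose limits cancel.
    have h1 := tendsto_besselIntegral_zero (v := v + 1) (by linarith)
    have h2 := tendsto_besselIntegral_zero (v := v + 1 + 1) (by linarith)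
    have h3 := (h1.mul (hs v)).add ((h2.sub (h1.const_mul (v + 1))).mul (hs (v + 1)))
    have hG : Gamma (v + 1) ≠ 0 := (Gamma_pos_of_pos (by linarith)).ne'
    rw [Gamma_add_one (s := v + 1) (by linarith), sub_self, zero_mul, add_zero,
      mul_inv_cancel₀ hG] at h3
    refine h3.congr' ?_
    filter_upwards [self_mem_nhdsWithin] with y hy
    have e := besselIntegral_add_one (v + 1) hy
    rw [add_sub_cancel_right] at e
    rw [hW, e]
    ring
  refine tendsto_nhds_unique (tendsto_const_nhds.congr' ?_) hl
  filter_upwards [self_mem_nhdsWithin] with y hy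
  exact (hc y hy).symm

/-- By the two recurrences the expression is unchanged under `v ↦ v + 1`, which reduces to `-1 < v`.
-/
theorem besselIntegral_wronskian (v : ℝ) {z : ℝ} (hz : 0 < z) :
    besselIntegral (v + 1) z * besselSeries v z +
      z * besselIntegral v z * besselSeries (v + 1) z = 1 := by
  have key : ∀ n : ℕ, ∀ v : ℝ, -1 < v + n → besselIntegral (v + 1) z * besselSeries v z +
      z * besselIntegral v z * besselSeries (v + 1) z = 1 := by
    intro n
    induction n with
    | zero => exact fun v hv => besselIntegral_wronskian_of_neg_one_lt (by simpa using hv) hz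
    | succ n ih =>
      intro v hv
      have h := ih (v + 1) (by push_cast at hv; linarith)
      have e1 := besselSeries_sub_one (v + 1) z
      have e2 := besselIntegral_add_one (v + 1) hz
      rw [add_sub_cancel_right] at e1 e2
      rw [e2] at h
      rw [e1]
      linear_combination h
  obtain ⟨n, hn⟩ := exists_nat_gt (-1 - v)
  exact key n v (by linarith)

/-- The Wronskians at `v - 1` and, after reflection, at `-v` are two linear equations in the
integrals of orders `v` and `v - 1`. Eliminating the latter leaves the Wronskian of `I_v`, `I_{-v}`
as coefficient. -/
theorem besselIntegral_mul_sin (v : ℝ) {z : ℝ} (hz : 0 < z) :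
    besselIntegral v z * (sin (π * v) / π) = besselSeries (-v) z - z ^ v * besselSeries v z := by
  have h1 := besselIntegral_wronskian (v - 1) hz
  have h2 := besselIntegral_wronskian (-v) hz
  have h3 := besselSeries_wronskian v z
  rw [sub_add_cancel] at h1
  rw [show -v + 1 = -(v - 1) by ring, besselIntegral_neg _ hz, besselIntegral_neg _ hz,
    show -(v - 1) = 1 - v by ring, rpow_sub hz, rpow_one, rpow_neg hz.le] at h2
  have hp : 0 < z ^ v := by positivity
  field_simp at h2
  rw [← h3]
  linear_combination besselSeries (-v) z * h1 - besselSeries v z * h2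

/-- Integral form of the modified Bessel function of the second kind, for `0 < x`. -/
noncomputable def besselKInt (v x : ℝ) : ℝ :=
  1 / 2 * (x / 2) ^ (-v) * besselIntegral v (x ^ 2 / 4)

theorem besselKQuot_eq {v x : ℝ} (hx : 0 < x) (hv : sin (v * π) ≠ 0) :
    besselKQuot v x = besselKInt v x := by
  have hz : 0 < x ^ 2 / 4 := by positivity
  have h := besselIntegral_mul_sin v hz
  have h2 : (x ^ 2 / 4) ^ v = (x / 2) ^ v * (x / 2) ^ v := by
    rw [← mul_rpow (by positivity) (by positivity)]
    congr 1
    ring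
  rw [mul_comm π v, h2] at h
  rw [besselKQuot, besselKInt, besselI_eq _ hx, besselI_eq _ hx, rpow_neg (by positivity)]
  have hp : 0 < (x / 2) ^ v := by positivity
  have hpi := pi_pos
  field_simp at h ⊢
  linear_combination -h

theorem sin_mul_pi_ne_zero {v : ℝ} (hv : v ∉ range ((↑) : ℤ → ℝ)) : sin (v * π) ≠ 0 := by
  intro h
  obtain ⟨n, hn⟩ := sin_eq_zero_iff.1 h
  exact hv ⟨n, mul_right_cancel₀ pi_ne_zero hn⟩

theorem besselK_eq (v : ℝ) {x : ℝ} (hx : 0 < x) : besselK v x = besselKInt v x := by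
  unfold besselK
  split_ifs with hv
  · have hc : Continuous fun μ => besselKInt μ x := by
      unfold besselKInt
      refine .mul (continuous_const.mul (.rpow continuous_const continuous_neg fun _ => .inl ?_))
        (continuous_besselIntegral_order (by positivity))
      positivity
    refine Tendsto.limUnder_eq (((hc.tendsto v).mono_left nhdsWithin_le_nhds).congr' ?_)
    -- The integers other than `v` are closed, so every `μ ≠ v` near `v` is a non-integer.
    have hclosed : IsClosed (((↑) : ℤ → ℝ) '' {n | (n : ℝ) ≠ v}) :=
      Int.isClosedEmbedding_coe_real.isClosedMap _ (isClosed_discrete _)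
    have hmem : (((↑) : ℤ → ℝ) '' {n | (n : ℝ) ≠ v})ᶜ ∈ 𝓝[≠] v := by
      refine mem_nhdsWithin_of_mem_nhds (hclosed.isOpen_compl.mem_nhds ?_)
      rintro ⟨n, hn, hn'⟩
      exact hn hn'
    filter_upwards [hmem, self_mem_nhdsWithin] with μ hμ hμv
    refine (besselKQuot_eq hx (sin_mul_pi_ne_zero ?_)).symm
    rintro ⟨n, rfl⟩
    exact hμ ⟨n, hμv, rfl⟩
  · exact besselKQuot_eq hx (sin_mul_pi_ne_zero hv)

/-! ### Positivity, recurrence, derivatives and decay of `K_v` -/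

theorem besselKInt_pos (v : ℝ) {x : ℝ} (hx : 0 < x) : 0 < besselKInt v x := by
  have := besselIntegral_pos v (z := x ^ 2 / 4) (by positivity)
  unfold besselKInt
  positivity

theorem besselKInt_add_one (v : ℝ) {x : ℝ} (hx : 0 < x) :
    besselKInt (v + 1) x = 2 * v / x * besselKInt v x + besselKInt (v - 1) x := by
  unfold besselKInt
  rw [besselIntegral_add_one v (by positivity), neg_add, ← sub_eq_add_neg,
    rpow_sub_one (by positivity), neg_sub, sub_eq_add_neg 1 v, rpow_add (by positivity), rpow_one]
  field_simp
  ring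

theorem hasDerivAt_besselKInt (v : ℝ) {x : ℝ} (hx : 0 < x) :
    HasDerivAt (besselKInt v) (-(v / x) * besselKInt v x - besselKInt (v - 1) x) x := by
  have h1 : HasDerivAt (fun x : ℝ => x ^ 2 / 4) (x / 2) x :=
    ((hasDerivAt_pow 2 x).div_const 4).congr_deriv (by norm_num; ring)
  have h2 := (hasDerivAt_besselIntegral v (z := x ^ 2 / 4) (by positivity)).comp x h1
  have h3 := (((hasDerivAt_id' x).div_const 2).rpow_const (p := -v)
    (Or.inl (by positivity))).const_mul (1 / 2)
  refine (h3.mul h2).congr_deriv ?_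
  unfold besselKInt
  rw [rpow_sub_one (by positivity), neg_sub, sub_eq_add_neg 1 v, rpow_add (by positivity), rpow_one,
    Function.comp_apply]
  field_simp
  ring

/-- Eliminating `K_{v-2}` closes the first-order linear system for `K_v`, `K_{v-1}`. -/
theorem hasDerivAt_besselKInt_sub_one (v : ℝ) {x : ℝ} (hx : 0 < x) :
    HasDerivAt (besselKInt (v - 1))
      ((v - 1) / x * besselKInt (v - 1) x - besselKInt v x) x := by
  refine (hasDerivAt_besselKInt (v - 1) hx).congr_deriv ?_
  have h := besselKInt_add_one (v - 1) hx
  rw [sub_add_cancel] at h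
  rw [h]
  ring

theorem tendsto_pow_mul_besselKInt (v : ℝ) (n : ℕ) :
    Tendsto (fun x => x ^ n * besselKInt v x) atTop (𝓝 0) := by
  -- `m > -v` makes `Gamma (v + m)` a convergent integral; `m > n - v` makes the bound a negative
  -- power of `x`.
  obtain ⟨m, hm⟩ := exists_nat_gt (max (-v) (n - v))
  have hm1 : 0 < v + m := by linarith [(max_lt_iff.1 hm).1]
  have hm2 : 0 < v + 2 * m - n := by
    linarith [(max_lt_iff.1 hm).2, (Nat.cast_nonneg m : (0 : ℝ) ≤ m)]
  have hlim := ((tendsto_rpow_neg_atTop hm2).comp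
    (tendsto_id.atTop_div_const (two_pos (α := ℝ)))).const_mul
    (1 / 2 * 2 ^ n * (m.factorial * Gamma (v + m)))
  rw [mul_zero] at hlim
  refine squeeze_zero' ?_ ?_ hlim
  · filter_upwards [eventually_gt_atTop 0] with x hx
    have := besselKInt_pos v hx
    positivity
  · filter_upwards [eventually_gt_atTop 0] with x hx
    have hb := pow_mul_besselIntegral_le v (z := x ^ 2 / 4) (by positivity) hm1
    have e1 : (x / 2) ^ (-(v + 2 * m - n)) * (x ^ 2 / 4) ^ m * 2 ^ n = x ^ n * (x / 2) ^ (-v) := by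
      rw [show -(v + 2 * m - n) = -v + n - (2 * m : ℕ) by push_cast; ring,
        rpow_sub (by positivity), rpow_add (by positivity), rpow_natCast, rpow_natCast, pow_mul,
        show (x / 2) ^ 2 = x ^ 2 / 4 by ring, div_pow x 2 n]
      field_simp
    calc x ^ n * besselKInt v x
        = 1 / 2 * 2 ^ n * (x / 2) ^ (-(v + 2 * m - n)) *
            ((x ^ 2 / 4) ^ m * besselIntegral v (x ^ 2 / 4)) := by
          rw [besselKInt]
          linear_combination (-1 / 2 * besselIntegral v (x ^ 2 / 4)) * e1
      _ ≤ 1 / 2 * 2 ^ n * (x / 2) ^ (-(v + 2 * m - n)) * (m.factorial * Gamma (v + m)) :=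
          mul_le_mul_of_nonneg_left hb (by positivity)
      _ = _ := by
          simp only [Function.comp_apply, id_eq]
          ring

/-- A function on `(0, ∞)` with negative derivative and limit `0` at infinity is positive. -/
theorem pos_of_deriv_neg_of_tendsto_zero {f f' : ℝ → ℝ}
    (hf : ∀ x, 0 < x → HasDerivAt f (f' x) x) (hf' : ∀ x, 0 < x → f' x < 0)
    (hlim : Tendsto f atTop (𝓝 0)) {x : ℝ} (hx : 0 < x) : 0 < f x := by
  have hanti : StrictAntiOn f (Ioi 0) := by
    refine strictAntiOn_of_deriv_neg (convex_Ioi 0)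
      (fun y hy => (hf y hy).continuousAt.continuousWithinAt) fun y hy => ?_
    rw [interior_Ioi] at hy
    rw [(hf y hy).deriv]
    exact hf' y hy
  have h1 : f (x + 1) < f x := hanti hx (by simp; linarith) (by linarith)
  refine lt_of_le_of_lt ?_ h1
  refine le_of_tendsto hlim ?_
  filter_upwards [eventually_ge_atTop (x + 1)] with y hy
  exact hanti.antitoneOn (by simp; linarith) (by simp; linarith) hy

theorem neg_of_deriv_pos_of_tendsto_zero {f f' : ℝ → ℝ}
    (hf : ∀ x, 0 < x → HasDerivAt f (f' x) x) (hf' : ∀ x, 0 < x → 0 < f' x)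
    (hlim : Tendsto f atTop (𝓝 0)) {x : ℝ} (hx : 0 < x) : f x < 0 := by
  have := pos_of_deriv_neg_of_tendsto_zero (f := -f) (f' := -f') (fun y hy => (hf y hy).neg)
    (fun y hy => neg_neg_of_pos (hf' y hy)) (by rw [← neg_zero]; exact hlim.neg) hx
  simpa using this

/-! ### The two monotonicity arguments -/

/-- A multiple of `(exp x * √x * K_v x)'`. -/
noncomputable def besselKAux (v x : ℝ) : ℝ :=
  (2 * x + 1 - 2 * v) * besselKInt v x - 2 * x * besselKInt (v - 1) x

/-- With `w = √x K_v`, Bessel's equation reads `w'' = (1 + (v² - 1/4)/x²) w`. The function here is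
`2 exp(-x)(w' + w)`, with derivative `2 exp(-x)(w'' - w)`. -/
theorem hasDerivAt_exp_mul_besselKAux (v : ℝ) {x : ℝ} (hx : 0 < x) :
    HasDerivAt (fun x => exp (-x) * x ^ (-(1 / 2) : ℝ) * besselKAux v x)
      (2 * (v ^ 2 - 1 / 4) * (exp (-x) * x ^ (-(1 / 2) : ℝ) * besselKInt v x / x)) x := by
  have ha := hasDerivAt_besselKInt v hx
  have hb := hasDerivAt_besselKInt_sub_one v hx
  have h1 : HasDerivAt (fun x : ℝ => 2 * x + 1 - 2 * v) 2 x :=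
    ((((hasDerivAt_id' x).const_mul 2).add_const 1).sub_const (2 * v)).congr_deriv (by ring)
  have h2 : HasDerivAt (fun x : ℝ => 2 * x) 2 x :=
    ((hasDerivAt_id' x).const_mul 2).congr_deriv (by ring)
  have h3 := (hasDerivAt_neg x).exp.mul
    (hasDerivAt_rpow_const (x := x) (p := -(1 / 2)) (Or.inl hx.ne'))
  refine (h3.mul ((h1.mul ha).sub (h2.mul hb))).congr_deriv ?_
  simp only [Pi.mul_apply, Pi.sub_apply]
  rw [rpow_sub_one hx.ne']
  field_simp
  ring

theorem tendsto_exp_mul_besselKAux (v : ℝ) :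
    Tendsto (fun x => exp (-x) * x ^ (-(1 / 2) : ℝ) * besselKAux v x) atTop (𝓝 0) := by
  have h1 := tendsto_pow_mul_besselKInt v 0
  have h2 := tendsto_pow_mul_besselKInt v 1
  have h3 := tendsto_pow_mul_besselKInt (v - 1) 1
  have h4 := ((h2.const_mul 2).add (h1.const_mul (1 - 2 * v))).sub (h3.const_mul 2)
  have h5 := ((tendsto_exp_neg_atTop_nhds_zero).mul
    (tendsto_rpow_neg_atTop (y := 1 / 2) (by norm_num))).mul h4
  simp only [mul_zero, zero_mul] at h5
  refine h5.congr fun x => ?_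
  unfold besselKAux
  ring

theorem besselKAux_neg {v : ℝ} (hv : 1 / 2 < |v|) {x : ℝ} (hx : 0 < x) : besselKAux v x < 0 := by
  have hv' : 0 < v ^ 2 - 1 / 4 := by
    rw [← sq_abs]; nlinarith
  have h := neg_of_deriv_pos_of_tendsto_zero
    (fun y hy => hasDerivAt_exp_mul_besselKAux v hy)
    (fun y hy => by have := besselKInt_pos v hy; positivity)
    (tendsto_exp_mul_besselKAux v) hx
  exact neg_of_mul_neg_right h (by positivity)

theorem besselKAux_pos {v : ℝ} (hv : |v| < 1 / 2) {x : ℝ} (hx : 0 < x) : 0 < besselKAux v x := by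
  have hv' : v ^ 2 - 1 / 4 < 0 := by
    rw [← sq_abs]; nlinarith [abs_nonneg v]
  have h := pos_of_deriv_neg_of_tendsto_zero
    (fun y hy => hasDerivAt_exp_mul_besselKAux v hy)
    (fun y hy => by
      have := besselKInt_pos v hy
      exact mul_neg_of_neg_of_pos (by linarith) (by positivity))
    (tendsto_exp_mul_besselKAux v) hx
  exact pos_of_mul_pos_right h (by positivity)

/-- `x ^ 2` times `(1 + 1 / x) * K_v x ^ 2 - K_{v-1} x * K_{v+1} x`. -/
noncomputable def besselKTuran (v x : ℝ) : ℝ :=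
  (x ^ 2 + x) * besselKInt v x ^ 2 - x ^ 2 * besselKInt (v - 1) x ^ 2 -
    2 * v * x * besselKInt v x * besselKInt (v - 1) x

theorem besselKTuran_eq (v : ℝ) {x : ℝ} (hx : 0 < x) :
    besselKTuran v x = x ^ 2 * ((1 + 1 / x) * besselKInt v x ^ 2 -
      besselKInt (v - 1) x * besselKInt (v + 1) x) := by
  rw [besselKTuran, besselKInt_add_one v hx]
  field_simp
  ring

theorem hasDerivAt_besselKTuran (v : ℝ) {x : ℝ} (hx : 0 < x) :
    HasDerivAt (besselKTuran v) (besselKInt v x * besselKAux v x) x := by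
  have ha := hasDerivAt_besselKInt v hx
  have hb := hasDerivAt_besselKInt_sub_one v hx
  have h1 := hasDerivAt_pow 2 x
  have h2 := (hasDerivAt_id' x).const_mul (2 * v)
  refine ((((h1.add (hasDerivAt_id' x)).mul (ha.pow 2)).sub (h1.mul (hb.pow 2))).sub
    ((h2.mul ha).mul hb)).congr_deriv ?_
  simp only [Pi.mul_apply, Pi.add_apply, Pi.pow_apply, besselKAux]
  push_cast
  field_simp
  ring

theorem tendsto_besselKTuran (v : ℝ) : Tendsto (besselKTuran v) atTop (𝓝 0) := by
  have h1 := tendsto_pow_mul_besselKInt v 0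
  have h2 := tendsto_pow_mul_besselKInt v 1
  have h3 := tendsto_pow_mul_besselKInt (v - 1) 1
  have h4 := (((h2.pow 2).add (h1.mul h2)).sub (h3.pow 2)).sub ((h1.mul h3).const_mul (2 * v))
  simp only [mul_zero, ne_eq, OfNat.ofNat_ne_zero, not_false_eq_true, zero_pow, add_zero,
    sub_zero] at h4
  refine h4.congr fun x => ?_
  unfold besselKTuran
  ring

theorem besselKTuran_pos {v : ℝ} (hv : 1 / 2 < |v|) {x : ℝ} (hx : 0 < x) :
    0 < besselKTuran v x :=
  pos_of_deriv_neg_of_tendsto_zero (fun _ hy => hasDerivAt_besselKTuran v hy)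
    (fun _ hy => mul_neg_of_pos_of_neg (besselKInt_pos v hy) (besselKAux_neg hv hy))
    (tendsto_besselKTuran v) hx

theorem besselKTuran_neg {v : ℝ} (hv : |v| < 1 / 2) {x : ℝ} (hx : 0 < x) :
    besselKTuran v x < 0 :=
  neg_of_deriv_pos_of_tendsto_zero (fun _ hy => hasDerivAt_besselKTuran v hy)
    (fun _ hy => mul_pos (besselKInt_pos v hy) (besselKAux_pos hv hy))
    (tendsto_besselKTuran v) hx

theorem mainTheorem8 (v x : ℝ) (hv : |v| ≠ 1 / 2) (hx : 0 < x) :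
    besselK v x ≠ 0 ∧
    (1 / 2 < |v| →
      besselK (v - 1) x * besselK (v + 1) x / besselK v x ^ 2 < 1 + 1 / x ∧
      besselK v x ^ 2 - besselK (v - 1) x * besselK (v + 1) x > -(1 / x) * besselK v x ^ 2) ∧
    (|v| < 1 / 2 →
      besselK (v - 1) x * besselK (v + 1) x / besselK v x ^ 2 > 1 + 1 / x ∧
      besselK v x ^ 2 - besselK (v - 1) x * besselK (v + 1) x < -(1 / x) * besselK v x ^ 2) := by
  simp only [besselK_eq _ hx]
  have ha := besselKInt_pos v hx
  have hT := besselKTuran_eq v hx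
  refine ⟨ha.ne', fun h => ?_, fun h => ?_⟩
  · have h1 := pos_of_mul_pos_right (hT ▸ besselKTuran_pos h hx) (by positivity)
    refine ⟨?_, by linarith⟩
    rw [div_lt_iff₀ (by positivity)]
    linarith
  · have h1 := neg_of_mul_neg_right (hT ▸ besselKTuran_neg h hx) (by positivity)
    refine ⟨?_, by linarith⟩
    rw [gt_iff_lt, lt_div_iff₀ (by positivity)]
    linarith
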